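/- Let $\nu_2$ denote the $2$-adic valuation on $\mathbb{Q}\setminus\{0\}$. For integers $0\le l\le M$ put $$d_{l,M}=2^{-2M}\sum_{k=l}^{M}2^k\binom{2M-2k}{M-k}\binom{M+k}{M}\binom{k}{l},\qquad A_{l,M}=l!\,M!\,2^{M+l}\,d_{l,M},$$ and for $l\ge 1$, $m\ge 1$ put $C_{l,m}=A_{l,\;l+2^{1+\nu_2(l)}(m-1)}$ (a positive rational number). For $l\ge 1$ the decision tree $T(l)$ is defined as follows. Its vertices are classes $\{2^k(m-1)+a: m\ge 1\}$ with $1\le a\le 2^k$, where $k$ is the generation. The root (generation $0$) is $\{m: m\ge1\}$. A vertex $\{2^k(m-1)+a\}$ is terminal, with label $c$, if $\nu_2(C_{l,2^k(m-1)+a})-\nu_2(m)=c$ for all $m\ge 1$; if no such constant $c$ exists, the vertex has exactly two children in generation $k+1$, namely $\{2^{k+1}(m-1)+a\}$ and $\{2^{k+1}(m-1)+2^k+a\}$. Let $k^*=k^*(l)=\lfloor\log_2 l\rfloor$. **Theorem.** Let $l\ge 1$ be an integer. 1) $T(l)$ depends only on the odd part of $l$, up to the labels: for every $r\ge 0$,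 $T(2^r l)=T(l)$ as unlabelled trees (same vertices, edges and terminal vertices). Moreover $\nu_2(C_{2^r l,m})=\nu_2(C_{l,m})+3(2^r-1)l$ for all $m\ge1$, so that all the labels are shifted by $3(2^r-1)l$. Assume from now on that $l$ is odd. (By 1), this determines $T(l)$, its labels and $\nu_2(C_{l,m})$ for every $l\ge1$.) 2) For $0\le k\le k^*$, the $k$-th generation of $T(l)$ has $2^k$ vertices, and no vertex of generation $k<k^*$ is terminal; that is, $T(l)$ is a complete binary tree through generation $k^*$. 3) Generation $k^*$ contains exactly $2^{k^*+1}-l$ terminal vertices. Define $$j_1(l,k,a)=-l+2(1+2^k-a),\qquad \gamma_1(l,k,a)=l+k+1+\nu_2((j_1+l-1)!)+\nu_2((l-j_1)!).$$ For $1\le a\le 2^{k^*+1}-l$ the class $\{2^{k^*}(m-1)+a\}$ is a terminal vertex of generation $k^*$ and, for all $m\ge 1$, $$\nu_2(C_{l,2^{k^*}(m-1)+a})=\nu_2(m)+\gamma_1(l,k^*,a).$$ 4) The remaining terminal vertices all lie in generation $k^*+1$. There are $2(l-2^{k^*})$ of them, they are all the vertices of that generation, and there are no vertices in later generations. Define $$j_2(l,k,a)=-l+2(1+2^{k+1}-a),\qquad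 j_3(l,k,a)=j_2(l,k,a+2^k),$$ $$\gamma_i(l,k,a)=l+k+2+\nu_2((j_i+l-1)!)+\nu_2((l-j_i)!)\qquad(i=2,3).$$ For $2^{k^*+1}-l+1\le a\le 2^{k^*}$ the classes $\{2^{k^*+1}(m-1)+a\}$ and $\{2^{k^*+1}(m-1)+a+2^{k^*}\}$ are terminal vertices of generation $k^*+1$ and, for all $m\ge1$, $$\nu_2(C_{l,2^{k^*+1}(m-1)+a})=\nu_2(m)+\gamma_2(l,k^*,a),\qquad \nu_2(C_{l,2^{k^*+1}(m-1)+a+2^{k^*}})=\nu_2(m)+\gamma_3(l,k^*,a).$$ -/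

import Mathlib

namespace QuarticValuation

open Nat

/-- The coefficients `d_{l,m} = 2^{-2m} ∑_{k=l}^m 2^k C(2m-2k,m-k) C(m+k,m) C(k,l)`. -/
def dCoeff (l m : ℕ) : ℚ :=
  (1 / 2 ^ (2 * m)) * ∑ k ∈ Finset.Icc l m,
    (2 : ℚ) ^ k * ((2 * m - 2 * k).choose (m - k) : ℚ) * ((m + k).choose m : ℚ) * (k.choose l : ℚ)

/-- `A_{l,m} = l! m! 2^{m+l} d_{l,m}`. -/
def ACoeff (l m : ℕ) : ℚ :=
  (l ! : ℚ) * (m ! : ℚ) * 2 ^ (m + l) * dCoeff l m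

/-- `C_{l,m} = A_{l, l + 2^{1+ν₂(l)} (m-1)}` for `m ≥ 1`: the sequence `A_{l,l}, A_{l,l+1}, …`
sampled at the first index of each block of length `2^{1+ν₂(l)}`. -/
def CSeq (l m : ℕ) : ℚ :=
  ACoeff l (l + 2 ^ (1 + padicValNat 2 l) * (m - 1))

/-- The 2-adic valuation of a rational number. It is only used at nonzero numbers,
see `CSeq_pos`. -/
def nu2 (x : ℚ) : ℤ := padicValRat 2 x

theorem dCoeff_pos {l m : ℕ} (h : l ≤ m) : 0 < dCoeff l m := by
  unfold dCoeff
  refine mul_pos (by positivity) (Finset.sum_pos (fun k hk => ?_) ⟨l, by simp [h]⟩)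
  rw [Finset.mem_Icc] at hk
  have h1 : 0 < (2 * m - 2 * k).choose (m - k) := Nat.choose_pos (by omega)
  have h2 : 0 < (m + k).choose m := Nat.choose_pos (by omega)
  have h3 : 0 < k.choose l := Nat.choose_pos hk.1
  positivity

theorem CSeq_pos (l m : ℕ) : 0 < CSeq l m := by
  have := dCoeff_pos (Nat.le_add_right l (2 ^ (1 + padicValNat 2 l) * (m - 1)))
  unfold CSeq ACoeff
  positivity

/-- The class `{2^k (m-1) + a : m ≥ 1}` yields the constant `c`: for all `m ≥ 1`,
`ν₂(C_{l, 2^k (m-1) + a}) - ν₂(m) = c`. -/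
def HasConstant (l k a : ℕ) (c : ℤ) : Prop :=
  ∀ m : ℕ, 1 ≤ m → nu2 (CSeq l (2 ^ k * (m - 1) + a)) - nu2 (m : ℚ) = c

/-- The question asked at the class `{2^k (m-1) + a : m ≥ 1}` has a positive answer. -/
def IsConstantClass (l k a : ℕ) : Prop := ∃ c : ℤ, HasConstant l k a c

/-- Vertices of the decision tree `T(l)`. `IsVertex l k a` says that the class
`{2^k (m-1) + a : m ≥ 1}` is a vertex of generation `k`. The root is the class of all `m ≥ 1`;
a vertex with a negative answer splits into two vertices of the next generation. -/
inductive IsVertex (l : ℕ) : ℕ → ℕ → Prop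
  | root : IsVertex l 0 1
  | left {k a : ℕ} : IsVertex l k a → ¬ IsConstantClass l k a → IsVertex l (k + 1) a
  | right {k a : ℕ} : IsVertex l k a → ¬ IsConstantClass l k a → IsVertex l (k + 1) (2 ^ k + a)

/-- Terminal vertices of `T(l)`: the vertices with a positive answer. -/
def IsTerminal (l k a : ℕ) : Prop := IsVertex l k a ∧ IsConstantClass l k a

/-- The terminal vertex `(k, a)` of `T(l)` carries the label `c`. -/
def HasLabel (l k a : ℕ) (c : ℤ) : Prop := IsVertex l k a ∧ HasConstant l k a c

/-- The vertices of generation `k` of `T(l)`, given by their residues `a`. -/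
def generation (l k : ℕ) : Set ℕ := {a | IsVertex l k a}

/-- The terminal vertices of generation `k` of `T(l)`. -/
def terminals (l k : ℕ) : Set ℕ := {a | IsTerminal l k a}

/-- An unlabelled rooted binary tree on vertices `(k, a)`: its vertices, its
parent-child edges and its terminal vertices. -/
@[ext] structure TreeShape where
  vertex : Set (ℕ × ℕ)
  edge : Set ((ℕ × ℕ) × (ℕ × ℕ))
  terminal : Set (ℕ × ℕ)

/-- The decision tree `T(l)` without its labels. -/
def treeShape (l : ℕ) : TreeShape where
  vertex := {v | IsVertex l v.1 v.2}
  edge := {e | IsVertex l e.1.1 e.1.2 ∧ IsVertex l e.2.1 e.2.2 ∧ e.2.1 = e.1.1 + 1 ∧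
    (e.2.2 = e.1.2 ∨ e.2.2 = 2 ^ e.1.1 + e.1.2)}
  terminal := {v | IsTerminal l v.1 v.2}

/-- `k*(l) = ⌊log₂ l⌋`. -/
def kStar (l : ℕ) : ℕ := Nat.log 2 l

def j1 (l k a : ℕ) : ℤ := -(l : ℤ) + 2 * (1 + 2 ^ k - (a : ℤ))

def j2 (l k a : ℕ) : ℤ := -(l : ℤ) + 2 * (1 + 2 ^ (k + 1) - (a : ℤ))

def j3 (l k a : ℕ) : ℤ := j2 l k (a + 2 ^ k)

/-- `ν₂(n!)` for an integer `n ≥ 0` (all uses are at nonnegative `n`). -/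
def nu2Factorial (n : ℤ) : ℤ := nu2 ((n.toNat ! : ℕ) : ℚ)

def gamma1 (l k a : ℕ) : ℤ :=
  l + k + 1 + nu2Factorial (j1 l k a + l - 1) + nu2Factorial (l - j1 l k a)

def gamma2 (l k a : ℕ) : ℤ :=
  l + k + 2 + nu2Factorial (j2 l k a + l - 1) + nu2Factorial (l - j2 l k a)

def gamma3 (l k a : ℕ) : ℤ :=
  l + k + 2 + nu2Factorial (j3 l k a + l - 1) + nu2Factorial (l - j3 l k a)

end QuarticValuation

open QuarticValuation

/-!
The whole theorem follows from the closed formula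
`ν₂(A_{l,m}) = l + ν₂((m - l + 1)(m - l + 2) ⋯ (m + l))` (`nu2_ACoeff`). The polynomial
`∑_l d_{l,m} a^l` satisfies a second-order differential equation, which gives a three-term
recurrence for `d_{l,m}` in `l` (`dCoeff_recurrence`). For the quotients
`B_l = A_{l,m} / (2^l (m - l + 1) ⋯ (m + l))` it reads
`B_l = (2m + 1) B_{l+1} - (m - l - 1)(m + l + 2) B_{l+2}`; here `B_m = 1` and the last product is
even, so every `B_l` is an odd integer (`exists_odd_eq_oddFactor`).

With `l = 2^v o`, `o` odd, the formula turns into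
`ν₂(C_{l,m}) = 3l - o + ν₂(m (m + 1) ⋯ (m + o - 1))` (`nu2_CSeq`), which shows at once how the
valuation depends on the power of two in `l`. For odd `l` the tree is read off from the multiples
of `2^k` among the `l` consecutive integers starting at `2^k (m - 1) + a`, where `1 ≤ a ≤ 2^k`.
If `2^k m` is the only one, every other integer in the block has the valuation of its distance to
`2^k m`, so the class is constant (`hasConstant_gamma1`). If `2^k m` and `2^k (m + 1)` both occur,
then `ν₂(C) - ν₂(m) ≥ ν₂(m + 1)` is unbounded (`not_isConstantClass`). The latter happens for all
`a` when `k < k*`, and for `a > 2^(k* + 1) - l` when `k = k*`; the children of these last classes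
fall under the former case.
-/

namespace QuarticValuation

open scoped Nat

/-! ### The recurrence in `l` for the coefficients -/

/-- The coefficients of `4^m P_m` in powers of `a + 1`, where `P_m(a) = ∑_l d_{l,m} a^l`. -/
def shiftedCoeff (m k : ℕ) : ℚ :=
  (2 : ℚ) ^ k * ((2 * m - 2 * k).choose (m - k) : ℚ) * ((m + k).choose m : ℚ)

theorem dCoeff_eq_sum_range (l m : ℕ) :
    dCoeff l m =
      (1 / 2 ^ (2 * m)) * ∑ k ∈ Finset.range (m + 1), shiftedCoeff m k * (k.choose l : ℚ) := by
  unfold dCoeff shiftedCoeff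
  congr 1
  refine Finset.sum_subset (fun k hk => ?_) (fun k hk hk' => ?_)
  · simp only [Finset.mem_Icc, Finset.mem_range] at *
    omega
  · simp only [Finset.mem_Icc, Finset.mem_range] at *
    rw [Nat.choose_eq_zero_of_lt (by omega : k < l)]
    simp

theorem dCoeff_eq_zero {l m : ℕ} (h : m < l) : dCoeff l m = 0 := by
  simp [dCoeff, Finset.Icc_eq_empty_of_lt h]

theorem shiftedCoeff_succ {m k : ℕ} (h : k < m) :
    ((m : ℚ) - k) * (m + k + 1) * shiftedCoeff m k =
      (k + 1) * (2 * m - 2 * k - 1) * shiftedCoeff m (k + 1) := by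
  obtain ⟨n, rfl⟩ := Nat.exists_eq_add_of_lt h
  have h1 : ((n : ℚ) + 1) * (2 * (n + 1)).choose (n + 1) =
      2 * (2 * n + 1) * (2 * n).choose n := by
    have := Nat.succ_mul_centralBinom_succ n
    simp only [Nat.centralBinom] at this
    exact_mod_cast this
  have h2 : (((k + n + 1 + k).choose (k + n + 1) : ℕ) : ℚ) * (k + n + 1 + k + 1) =
      ((k + n + 1 + k + 1).choose (k + n + 1) : ℕ) * (k + 1) := by
    have := Nat.choose_mul_succ_eq (k + n + 1 + k) (k + n + 1)
    rw [show k + n + 1 + k + 1 - (k + n + 1) = k + 1 by omega] at this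
    exact_mod_cast this
  unfold shiftedCoeff
  rw [show 2 * (k + n + 1) - 2 * k = 2 * (n + 1) by omega, show k + n + 1 - k = n + 1 by omega,
    show 2 * (k + n + 1) - 2 * (k + 1) = 2 * n by omega,
    show k + n + 1 - (k + 1) = n by omega, ← add_assoc (k + n + 1) k 1]
  push_cast
  calc _ = 2 ^ k * (((n : ℚ) + 1) * (2 * (n + 1)).choose (n + 1)) *
        (((k + n + 1 + k).choose (k + n + 1) : ℕ) * (k + n + 1 + k + 1)) := by ring
    _ = _ := by rw [h1, h2]; ring

/-- Coefficientwise form of the differential equation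
`(1 - a²) P'' - (2m + 1 + 2a) P' + m (m + 1) P = 0` for `P(a) = ∑_l d_{l,m} a^l`. In powers of
`a + 1` the equation becomes the two-term recurrence `shiftedCoeff_succ`. -/
theorem dCoeff_recurrence (l m : ℕ) :
    ((m : ℚ) - l) * (m + l + 1) * dCoeff l m =
      (l + 1) * (2 * m + 1) * dCoeff (l + 1) m - (l + 2) * (l + 1) * dCoeff (l + 2) m := by
  have shift : ∑ k ∈ Finset.range (m + 1),
        ((m : ℚ) - k) * (m + k + 1) * shiftedCoeff m k * (k.choose l : ℚ) =
      ∑ k ∈ Finset.range (m + 1),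
        (l + 1) * (2 * m - 2 * k + 1) * shiftedCoeff m k * (k.choose (l + 1) : ℚ) := by
    rw [Finset.sum_range_succ, Finset.sum_range_succ' (fun k : ℕ =>
      ((l : ℚ) + 1) * (2 * m - 2 * k + 1) * shiftedCoeff m k * (k.choose (l + 1) : ℚ))]
    simp only [sub_self, zero_mul, add_zero, Nat.choose_zero_succ, Nat.cast_zero, mul_zero]
    refine Finset.sum_congr rfl fun k hk => ?_
    have h1 : ((k : ℚ) + 1) * k.choose l = (k + 1).choose (l + 1) * (l + 1) := by
      exact_mod_cast Nat.add_one_mul_choose_eq k l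
    rw [shiftedCoeff_succ (Finset.mem_range.1 hk)]
    push_cast
    linear_combination (2 * (m : ℚ) - 2 * k - 1) * shiftedCoeff m (k + 1) * h1
  have key : ∑ k ∈ Finset.range (m + 1), ((m : ℚ) - l) * (m + l + 1) *
        (shiftedCoeff m k * (k.choose l : ℚ)) =
      ∑ k ∈ Finset.range (m + 1), (((l : ℚ) + 1) * (2 * m + 1) *
        (shiftedCoeff m k * (k.choose (l + 1) : ℚ)) -
        (l + 2) * (l + 1) * (shiftedCoeff m k * (k.choose (l + 2) : ℚ))) := by
    rw [← sub_eq_zero] at shift ⊢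
    rw [← Finset.sum_sub_distrib] at shift ⊢
    rw [← shift]
    refine Finset.sum_congr rfl fun k _ => ?_
    have choose_succ (j : ℕ) : ((j : ℚ) + 1) * k.choose (j + 1) = (k - j) * k.choose j := by
      rcases le_or_gt j k with hj | hj
      · have := Nat.choose_succ_right_eq k j
        zify [hj] at this
        have : ((k.choose (j + 1) : ℕ) : ℚ) * (j + 1) = k.choose j * (k - j) := by
          exact_mod_cast this
        linarith
      · simp [Nat.choose_eq_zero_of_lt hj, Nat.choose_eq_zero_of_lt (hj.trans (Nat.lt_succ_self j))]
    have h1 := choose_succ l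
    have h2 := choose_succ (l + 1)
    push_cast at h2
    rw [show l + 1 + 1 = l + 2 from rfl] at h2
    linear_combination shiftedCoeff m k * ((l + 1) * h2 - (k + l + 1) * h1)
  rw [← Finset.mul_sum, Finset.sum_sub_distrib, ← Finset.mul_sum, ← Finset.mul_sum] at key
  simp only [dCoeff_eq_sum_range]
  linear_combination (1 / 2 ^ (2 * m)) * key

/-! ### The valuation of `A_{l,m}` -/

/-- The quotient `A_{l,m} / (2^l (m - l + 1)(m - l + 2) ⋯ (m + l))`, for `l ≤ m`. -/
def oddFactor (m l : ℕ) : ℚ :=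
  (l ! : ℚ) * (m ! : ℚ) * 2 ^ m * dCoeff l m * ((m - l)! : ℚ) / ((m + l)! : ℚ)

theorem oddFactor_self (m : ℕ) : oddFactor m m = 1 := by
  have h : (((m + m).choose m : ℕ) : ℚ) * m ! * m ! = (m + m)! := by
    exact_mod_cast Nat.add_choose_mul_factorial_mul_factorial m m
  have h0 : ((m + m)! : ℚ) ≠ 0 := by positivity
  simp only [oddFactor, dCoeff, Finset.Icc_self, Finset.sum_singleton, Nat.sub_self,
    Nat.choose_self, Nat.factorial_zero, Nat.cast_one]
  rw [div_eq_one_iff_eq h0, ← h, two_mul m, pow_add]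
  field_simp

theorem oddFactor_recurrence {m l : ℕ} (h : l < m) :
    oddFactor m l = (2 * m + 1) * oddFactor m (l + 1) -
      ((m : ℚ) - l - 1) * (m + l + 2) * oddFactor m (l + 2) := by
  obtain ⟨n, rfl⟩ := Nat.exists_eq_add_of_lt h
  have hd := dCoeff_recurrence l (l + n + 1)
  have hf : ((l + n + 1 + l)! : ℚ) ≠ 0 := by positivity
  unfold oddFactor
  rw [show l + n + 1 - l = n + 1 by omega, show l + n + 1 - (l + 1) = n by omega,
    show l + n + 1 + (l + 1) = l + n + 1 + l + 1 by omega,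
    show l + n + 1 + (l + 2) = l + n + 1 + l + 1 + 1 by omega]
  rcases n with _ | n
  · rw [dCoeff_eq_zero (by omega : l + 0 + 1 < l + 2)] at hd ⊢
    simp only [Nat.factorial_succ] at *
    push_cast at *
    field_simp
    linear_combination (2 * (l : ℚ) + 3) * hd
  · rw [show l + (n + 1) + 1 - (l + 2) = n by omega]
    simp only [Nat.factorial_succ] at *
    push_cast at *
    field_simp
    linear_combination ((n : ℚ) + 1) * (n + 2 * l + 4) * hd

/-- The factor is an odd integer: in the recurrence, the product `(m - l - 1) (m + l + 2)` of two
integers of opposite parity is even, so the parity propagates down from `oddFactor m m = 1`. -/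
theorem exists_odd_eq_oddFactor {m l : ℕ} (h : l ≤ m) : ∃ b : ℤ, Odd b ∧ oddFactor m l = b := by
  suffices H : (∃ b : ℤ, Odd b ∧ oddFactor m l = b) ∧ ∃ z : ℤ, oddFactor m (l + 1) = z from H.1
  induction h using Nat.decreasingInduction with
  | self =>
    refine ⟨⟨1, odd_one, by simp [oddFactor_self]⟩, 0, ?_⟩
    simp [oddFactor, dCoeff_eq_zero]
  | of_succ l hl ih =>
    obtain ⟨⟨b, hb, hb'⟩, z, hz⟩ := ih
    refine ⟨⟨(2 * m + 1) * b - (m - l - 1) * (m + l + 2) * z, ?_, ?_⟩, b, hb'⟩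
    · refine Odd.sub_even (Odd.mul ⟨m, rfl⟩ hb) (Even.mul_right ?_ z)
      have := Int.even_mul_succ_self ((m : ℤ) - l - 1)
      rw [Int.even_mul] at this ⊢
      refine this.imp id fun h => ?_
      rw [show (m : ℤ) + l + 2 = (m - l - 1 + 1) + 2 * (l + 1) by ring]
      exact h.add (even_two_mul _)
    · rw [oddFactor_recurrence hl, hb', hz]
      push_cast
      ring

theorem nu2_mul {x y : ℚ} (hx : x ≠ 0) (hy : y ≠ 0) : nu2 (x * y) = nu2 x + nu2 y :=
  padicValRat.mul hx hy

theorem nu2_natCast (n : ℕ) : nu2 (n : ℚ) = padicValNat 2 n := padicValRat.of_nat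

theorem nu2_two_pow (n : ℕ) : nu2 (2 ^ n) = n := by
  have := nu2_natCast (2 ^ n)
  rw [padicValNat.prime_pow] at this
  exact_mod_cast this

theorem nu2_intCast_of_odd {b : ℤ} (hb : Odd b) : nu2 (b : ℚ) = 0 := by
  rw [nu2, padicValRat.of_int, padicValInt.eq_zero_of_not_dvd]
  · rfl
  · exact fun h => Int.not_even_iff_odd.2 hb (even_iff_two_dvd.2 (by exact_mod_cast h))

theorem nu2_ACoeff (l n : ℕ) :
    nu2 (ACoeff l (l + n)) = l + padicValNat 2 (2 * l + n)! - padicValNat 2 n ! := by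
  obtain ⟨b, hb, hb'⟩ := exists_odd_eq_oddFactor (Nat.le_add_right l n)
  have hb0 : (b : ℚ) ≠ 0 := by
    rintro h
    rw [Int.cast_eq_zero.1 h] at hb
    exact Int.not_odd_zero hb
  have hn : (n ! : ℚ) ≠ 0 := by positivity
  have hln : ((2 * l + n)! : ℚ) ≠ 0 := by positivity
  have hA : ACoeff l (l + n) * n ! = 2 ^ l * b * (2 * l + n)! := by
    rw [← hb', oddFactor, ACoeff, Nat.add_sub_cancel_left, show l + n + l = 2 * l + n by omega]
    field_simp
    ring
  have hA0 : ACoeff l (l + n) ≠ 0 := by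
    intro h
    rw [h, zero_mul] at hA
    exact mul_ne_zero (mul_ne_zero (by positivity) hb0) hln hA.symm
  have := congrArg nu2 hA
  rw [nu2_mul hA0 hn, nu2_mul (by positivity) hln, nu2_mul (by positivity) hb0, nu2_two_pow,
    nu2_intCast_of_odd hb, nu2_natCast, nu2_natCast] at this
  linarith

/-! ### The valuation of `C_{l,m}` -/

theorem padicValNat_two_pow_mul_factorial (s n : ℕ) :
    padicValNat 2 (2 ^ s * n)! + n = padicValNat 2 n ! + 2 ^ s * n := by
  induction s with
  | zero => simp
  | succ s ih =>
    rw [pow_succ', mul_assoc, padicValNat_factorial_mul]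
    omega

/-- With `l = 2^v o`, `o` odd, the valuation of `C_{l,m}` is `3l - o` plus that of the product
`m (m + 1) ⋯ (m + o - 1)`. -/
theorem nu2_CSeq (v o m : ℕ) (ho : Odd o) :
    nu2 (CSeq (2 ^ v * o) m) =
      3 * (2 ^ v * o : ℕ) - o + padicValNat 2 (o + (m - 1))! - padicValNat 2 (m - 1)! := by
  have hv : padicValNat 2 (2 ^ v * o) = v := by
    rw [padicValNat.mul (by positivity) ho.pos.ne', padicValNat.prime_pow,
      padicValNat.eq_zero_of_not_dvd ho.not_two_dvd_nat, add_zero]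
  rw [CSeq, hv, nu2_ACoeff,
    show 2 * (2 ^ v * o) + 2 ^ (1 + v) * (m - 1) = 2 ^ (1 + v) * (o + (m - 1)) by ring]
  have h1 := padicValNat_two_pow_mul_factorial (1 + v) (o + (m - 1))
  have h2 := padicValNat_two_pow_mul_factorial (1 + v) (m - 1)
  have h3 : 2 ^ (1 + v) * (o + (m - 1)) = 2 * (2 ^ v * o) + 2 ^ (1 + v) * (m - 1) := by ring
  omega

theorem nu2_CSeq_of_odd {l : ℕ} (hl : Odd l) (m : ℕ) :
    nu2 (CSeq l m) = 2 * l + padicValNat 2 (l + (m - 1))! - padicValNat 2 (m - 1)! := by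
  have := nu2_CSeq 0 l m hl
  simp only [pow_zero, one_mul] at this
  rw [this]
  ring

theorem nu2_CSeq_two_pow_mul {l : ℕ} (hl : 1 ≤ l) (r m : ℕ) :
    nu2 (CSeq (2 ^ r * l) m) = nu2 (CSeq l m) + 3 * (2 ^ r - 1) * (l : ℤ) := by
  obtain ⟨v, o, ho, rfl⟩ := Nat.exists_eq_two_pow_mul_odd (by omega : l ≠ 0)
  rw [← mul_assoc, ← pow_add, nu2_CSeq _ _ _ ho, nu2_CSeq _ _ _ ho, pow_add]
  push_cast
  ring

/-! ### Blocks of consecutive integers -/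

theorem two_pow_dvd_iff_of_add {N i K e : ℕ} (hN : 2 ^ K ∣ N) (hi : i ≠ 0) (hiK : i < 2 ^ K)
    {j : ℕ} (hij : j = N + i ∨ N = j + i) : 2 ^ e ∣ j ↔ 2 ^ e ∣ i := by
  rcases le_or_gt e K with he | he
  · have hN' := (pow_dvd_pow 2 he).trans hN
    rcases hij with rfl | rfl
    · exact Nat.dvd_add_right hN'
    · exact ⟨fun h => (Nat.dvd_add_right h).1 hN', fun h => (Nat.dvd_add_left h).1 hN'⟩
  · -- for `e > K` neither side holds: already `2 ^ K` does not divide `i`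
    have hi' : ¬ 2 ^ K ∣ i := fun h => absurd (Nat.le_of_dvd (by omega) h) (by omega)
    have hj' : ¬ 2 ^ K ∣ j := by
      rcases hij with rfl | rfl
      · exact fun h => hi' ((Nat.dvd_add_right hN).1 h)
      · exact fun h => hi' ((Nat.dvd_add_right h).1 hN)
    have hK := pow_dvd_pow 2 he.le
    exact ⟨fun h => absurd (hK.trans h) hj', fun h => absurd (hK.trans h) hi'⟩

/-- `ν₂(N ± i) = ν₂(i)` when `2 ^ K ∣ N` and `0 < i < 2 ^ K`. -/
theorem padicValNat_two_eq_of_add {N i K : ℕ} (hN : 2 ^ K ∣ N) (hi : i ≠ 0) (hiK : i < 2 ^ K)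
    {j : ℕ} (hj : j ≠ 0) (hij : j = N + i ∨ N = j + i) : padicValNat 2 j = padicValNat 2 i := by
  refine eq_of_forall_le_iff fun e => ?_
  rw [← padicValNat_dvd_iff_le hj, ← padicValNat_dvd_iff_le hi,
    two_pow_dvd_iff_of_add hN hi hiK hij]

theorem padicValNat_factorial_succ (n : ℕ) :
    padicValNat 2 (n + 1)! = padicValNat 2 (n + 1) + padicValNat 2 n ! := by
  rw [Nat.factorial_succ, padicValNat.mul (by omega) (Nat.factorial_ne_zero n)]

theorem padicValNat_add_factorial {N K t : ℕ} (hN : 2 ^ K ∣ N) (ht : t < 2 ^ K) :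
    padicValNat 2 (N + t)! = padicValNat 2 N ! + padicValNat 2 t ! := by
  induction t with
  | zero => simp
  | succ t ih =>
    rw [← add_assoc, padicValNat_factorial_succ, padicValNat_factorial_succ, ih (by omega),
      add_assoc N t 1, padicValNat_two_eq_of_add hN (by omega) ht (by omega) (Or.inl rfl)]
    ring

theorem padicValNat_factorial_of_add {N K s n : ℕ} (hN : 2 ^ K ∣ N) (hs : s < 2 ^ K)
    (h : N = n + s + 1) :
    padicValNat 2 N ! = padicValNat 2 N + padicValNat 2 n ! + padicValNat 2 s ! := by
  induction s generalizing n with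
  | zero => rw [h, padicValNat_factorial_succ]; simp
  | succ s ih =>
    rw [ih (by omega) (by omega : N = n + 1 + s + 1), padicValNat_factorial_succ n,
      padicValNat_factorial_succ s,
      padicValNat_two_eq_of_add hN (by omega : s + 1 ≠ 0) hs (by omega : n + 1 ≠ 0)
        (Or.inr (by omega))]
    ring

theorem padicValNat_factorial_mono {a b : ℕ} (h : a ≤ b) :
    padicValNat 2 a ! ≤ padicValNat 2 b ! :=
  (padicValNat_dvd_iff_le (Nat.factorial_ne_zero b)).1
    (pow_padicValNat_dvd.trans (Nat.factorial_dvd_factorial h))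

/-! ### Constant and non-constant classes -/

theorem nu2Factorial_two_mul (n : ℕ) :
    nu2Factorial (2 * (n : ℤ)) = n + padicValNat 2 n ! := by
  rw [nu2Factorial, nu2_natCast, show (2 * (n : ℤ)).toNat = 2 * n by omega,
    padicValNat_factorial_mul]
  push_cast
  ring

theorem nu2Factorial_two_mul_add_one (n : ℕ) :
    nu2Factorial (2 * (n : ℤ) + 1) = n + padicValNat 2 n ! := by
  rw [nu2Factorial, nu2_natCast, show (2 * (n : ℤ) + 1).toNat = 2 * n + 1 by omega,
    padicValNat_factorial_mul_add _ (by norm_num), padicValNat_factorial_mul]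
  push_cast
  ring

/-- The hypotheses say that the `l` consecutive integers starting at `2^k (m - 1) + a` contain
exactly one multiple of `2^k`, namely `2^k m`. -/
theorem hasConstant_gamma1 {l k a : ℕ} (hl : Odd l) (ha : 1 ≤ a) (hak : a ≤ 2 ^ k)
    (h1 : 2 ^ k + 1 ≤ a + l) (h2 : a + l ≤ 2 ^ (k + 1)) : HasConstant l k a (gamma1 l k a) := by
  intro m hm
  obtain ⟨m, rfl⟩ := Nat.exists_eq_add_of_le' hm
  obtain ⟨s, hs⟩ := Nat.exists_eq_add_of_le hak
  obtain ⟨t, ht⟩ := Nat.exists_eq_add_of_le h1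
  rw [pow_succ] at h2
  have hN : 2 ^ k ∣ 2 ^ k * (m + 1) := dvd_mul_right _ _
  have e : 2 ^ k * (m + 1) = 2 ^ k * m + 2 ^ k := by ring
  have above := padicValNat_add_factorial hN (by omega : t < 2 ^ k)
  have below := padicValNat_factorial_of_add hN (by omega : s < 2 ^ k)
    (by omega : 2 ^ k * (m + 1) = 2 ^ k * m + a - 1 + s + 1)
  have hval : padicValNat 2 (2 ^ k * (m + 1)) = k + padicValNat 2 (m + 1) := by
    rw [padicValNat.mul (by positivity) (by omega), padicValNat.prime_pow]
  have hg : gamma1 l k a =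
      l + k + 1 + (s + padicValNat 2 s !) + (t + padicValNat 2 t !) := by
    zify at hs ht
    rw [← nu2Factorial_two_mul_add_one s, ← nu2Factorial_two_mul t, gamma1, j1]
    congr 3 <;> linarith
  rw [nu2_CSeq_of_odd hl, nu2_natCast, hg, Nat.add_sub_cancel,
    show l + (2 ^ k * m + a - 1) = 2 ^ k * (m + 1) + t by omega]
  omega

/-- The `l` consecutive integers starting at `2^k (m - 1) + a` contain both `2^k m` and
`2^k (m + 1)`, and `ν₂(m + 1)` is unbounded. -/
theorem not_isConstantClass {l k a : ℕ} (hl : Odd l) (ha : 1 ≤ a) (hak : a ≤ 2 ^ k)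
    (h : 2 ^ (k + 1) + 1 ≤ a + l) : ¬ IsConstantClass l k a := by
  rintro ⟨c, hc⟩
  suffices H : ∀ m : ℕ, (padicValNat 2 (m + 2) : ℤ) ≤ c by
    have := H (2 ^ (c.toNat + 1 + 1) - 2)
    have h4 : 2 ≤ 2 ^ (c.toNat + 1 + 1) := by
      rw [pow_succ]
      have := Nat.one_le_two_pow (n := c.toNat + 1)
      omega
    rw [Nat.sub_add_cancel h4, padicValNat.prime_pow] at this
    omega
  intro m
  have hm := hc (m + 1) (by omega)
  rw [nu2_CSeq_of_odd hl, nu2_natCast, Nat.add_sub_cancel] at hm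
  rw [pow_succ] at h
  -- `2^k (m + 1)` and `2^k (m + 2)` contribute to separate factors of the factorial quotient
  have hmul (n : ℕ) : padicValNat 2 (2 ^ k * (n + 1))! =
      k + padicValNat 2 (n + 1) + padicValNat 2 (2 ^ k * (n + 1) - 1)! := by
    obtain ⟨q, hq⟩ := Nat.exists_eq_add_of_le'
      (Nat.succ_le_of_lt (by positivity : 0 < 2 ^ k * (n + 1)))
    have := padicValNat_factorial_succ q
    have hval : padicValNat 2 (2 ^ k * (n + 1)) = k + padicValNat 2 (n + 1) := by
      rw [padicValNat.mul (by positivity) (by omega), padicValNat.prime_pow]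
    rw [← hval, hq, Nat.add_sub_cancel]
    exact this
  have e1 : 2 ^ k * (m + 1) = 2 ^ k * m + 2 ^ k := by ring
  have e2 : 2 ^ k * (m + 1 + 1) = 2 ^ k * (m + 1) + 2 ^ k := by ring
  have m1 := hmul m
  have m2 := hmul (m + 1)
  have l1 := padicValNat_factorial_mono
    (by omega : 2 ^ k * m + a - 1 ≤ 2 ^ k * (m + 1) - 1)
  have l2 := padicValNat_factorial_mono
    (by omega : 2 ^ k * (m + 1) ≤ 2 ^ k * (m + 1 + 1) - 1)
  have l3 := padicValNat_factorial_mono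
    (by omega : 2 ^ k * (m + 1 + 1) ≤ l + (2 ^ k * m + a - 1))
  rw [show m + 1 + 1 = m + 2 from rfl] at *
  omega

/-! ### The decision tree -/

theorem isVertex_succ_iff {l k b : ℕ} : IsVertex l (k + 1) b ↔
    ∃ a, IsVertex l k a ∧ ¬ IsConstantClass l k a ∧ (b = a ∨ b = 2 ^ k + a) := by
  constructor
  · rintro (_ | ⟨h, h'⟩ | ⟨h, h'⟩)
    · exact ⟨_, h, h', Or.inl rfl⟩
    · exact ⟨_, h, h', Or.inr rfl⟩
  · rintro ⟨a, h, h', rfl | rfl⟩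
    · exact .left h h'
    · exact .right h h'

theorem treeShape_eq_of_isConstantClass_iff {l l' : ℕ}
    (h : ∀ k a, IsConstantClass l k a ↔ IsConstantClass l' k a) : treeShape l = treeShape l' := by
  have hv (k : ℕ) : ∀ a, IsVertex l k a ↔ IsVertex l' k a := by
    induction k with
    | zero => exact fun a => ⟨fun h => by cases h; exact .root, fun h => by cases h; exact .root⟩
    | succ k ih => simp only [isVertex_succ_iff, ih, h, implies_true]
  simp only [treeShape, IsTerminal, hv, h]

theorem treeShape_two_pow_mul {l : ℕ} (hl : 1 ≤ l) (r : ℕ) :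
    treeShape (2 ^ r * l) = treeShape l := by
  refine treeShape_eq_of_isConstantClass_iff fun k a => ?_
  simp only [IsConstantClass, HasConstant, nu2_CSeq_two_pow_mul hl]
  constructor
  · rintro ⟨c, hc⟩
    exact ⟨c - 3 * (2 ^ r - 1) * l, fun m hm => by rw [← hc m hm]; ring⟩
  · rintro ⟨c, hc⟩
    exact ⟨c + 3 * (2 ^ r - 1) * l, fun m hm => by rw [← hc m hm]; ring⟩

theorem two_pow_kStar_le {l : ℕ} (hl : 1 ≤ l) : 2 ^ kStar l ≤ l :=
  Nat.pow_log_le_self 2 (by omega)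

theorem lt_two_pow_kStar_succ (l : ℕ) : l < 2 ^ (kStar l + 1) :=
  Nat.lt_pow_succ_log_self (by norm_num) l

theorem not_isConstantClass_of_lt_kStar {l k a : ℕ} (hl : Odd l) (hk : k < kStar l)
    (ha : 1 ≤ a) (hak : a ≤ 2 ^ k) : ¬ IsConstantClass l k a := by
  refine not_isConstantClass hl ha hak ?_
  have := (Nat.pow_le_pow_right (by norm_num : 0 < 2) hk).trans (two_pow_kStar_le hl.pos)
  rw [Nat.succ_eq_add_one] at this
  omega

theorem generation_eq_Icc {l k : ℕ} (hl : Odd l) (hk : k ≤ kStar l) :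
    generation l k = Set.Icc 1 (2 ^ k) := by
  induction k with
  | zero =>
    ext a
    simp only [generation, Set.mem_ofPred_eq, Set.mem_Icc, pow_zero]
    refine ⟨fun h => by cases h; simp, fun h => ?_⟩
    rw [show a = 1 by omega]
    exact .root
  | succ k ih =>
    have ih' (a : ℕ) : IsVertex l k a ↔ 1 ≤ a ∧ a ≤ 2 ^ k := Set.ext_iff.1 (ih (by omega)) a
    ext b
    simp only [generation, Set.mem_ofPred_eq, Set.mem_Icc, isVertex_succ_iff, ih', pow_succ]
    constructor
    · rintro ⟨a, ha, -, rfl | rfl⟩ <;> omega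
    · rintro ⟨h1, h2⟩
      rcases le_or_gt b (2 ^ k) with hb | hb
      · exact ⟨b, ⟨h1, hb⟩, not_isConstantClass_of_lt_kStar hl hk h1 hb, Or.inl rfl⟩
      · exact ⟨b - 2 ^ k, ⟨by omega, by omega⟩,
          not_isConstantClass_of_lt_kStar hl hk (by omega) (by omega), Or.inr (by omega)⟩

theorem isVertex_kStar_iff {l a : ℕ} (hl : Odd l) :
    IsVertex l (kStar l) a ↔ 1 ≤ a ∧ a ≤ 2 ^ kStar l :=
  Set.ext_iff.1 (generation_eq_Icc hl le_rfl) a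

theorem hasConstant_kStar {l a : ℕ} (hl : Odd l) (ha : 1 ≤ a)
    (ha' : a ≤ 2 ^ (kStar l + 1) - l) : HasConstant l (kStar l) a (gamma1 l (kStar l) a) := by
  have h1 := two_pow_kStar_le hl.pos
  have h2 := lt_two_pow_kStar_succ l
  refine hasConstant_gamma1 hl ha ?_ (by omega) (by omega)
  rw [pow_succ] at *
  omega

theorem isConstantClass_kStar_iff {l a : ℕ} (hl : Odd l) (ha : 1 ≤ a) (ha' : a ≤ 2 ^ kStar l) :
    IsConstantClass l (kStar l) a ↔ a ≤ 2 ^ (kStar l + 1) - l := by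
  refine ⟨fun h => ?_, fun h => ⟨_, hasConstant_kStar hl ha h⟩⟩
  by_contra hlt
  exact not_isConstantClass hl ha ha' (by omega) h

theorem terminals_kStar {l : ℕ} (hl : Odd l) :
    terminals l (kStar l) = Set.Icc 1 (2 ^ (kStar l + 1) - l) := by
  have h1 := two_pow_kStar_le hl.pos
  ext a
  simp only [terminals, IsTerminal, Set.mem_ofPred_eq, Set.mem_Icc, isVertex_kStar_iff hl]
  constructor
  · rintro ⟨⟨ha, ha'⟩, h⟩
    exact ⟨ha, (isConstantClass_kStar_iff hl ha ha').1 h⟩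
  · rintro ⟨ha, h⟩
    have ha' : a ≤ 2 ^ kStar l := by
      rw [pow_succ] at h
      omega
    exact ⟨⟨ha, ha'⟩, (isConstantClass_kStar_iff hl ha ha').2 h⟩

/-- The two children of a non-terminal vertex of generation `k*` are again classes with a single
multiple of `2^(k* + 1)` in each block, hence constant. -/
theorem hasConstant_kStar_succ {l a : ℕ} (hl : Odd l) (ha : 2 ^ (kStar l + 1) - l + 1 ≤ a)
    (ha' : a ≤ 2 ^ kStar l) :
    HasConstant l (kStar l + 1) a (gamma2 l (kStar l) a) ∧
      HasConstant l (kStar l + 1) (a + 2 ^ kStar l) (gamma3 l (kStar l) a) := by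
  have h1 := two_pow_kStar_le hl.pos
  have h2 := lt_two_pow_kStar_succ l
  have e2 : gamma2 l (kStar l) a = gamma1 l (kStar l + 1) a := by
    simp only [gamma2, gamma1, j2, j1]
    push_cast
    ring
  have e3 : gamma3 l (kStar l) a = gamma1 l (kStar l + 1) (a + 2 ^ kStar l) := by
    simp only [gamma3, gamma1, j3, j2, j1]
    push_cast
    ring
  rw [e2, e3]
  have e4 : 2 ^ (kStar l + 1) = 2 ^ kStar l * 2 := pow_succ _ _
  have e5 : 2 ^ (kStar l + 1 + 1) = 2 ^ kStar l * 2 * 2 := by rw [pow_succ, pow_succ]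
  exact ⟨hasConstant_gamma1 hl (by omega) (by omega) (by omega) (by omega),
    hasConstant_gamma1 hl (by omega) (by omega) (by omega) (by omega)⟩

theorem isVertex_kStar_succ_iff {l b : ℕ} (hl : Odd l) : IsVertex l (kStar l + 1) b ↔
    ∃ a, (2 ^ (kStar l + 1) - l + 1 ≤ a ∧ a ≤ 2 ^ kStar l) ∧ (b = a ∨ b = a + 2 ^ kStar l) := by
  rw [isVertex_succ_iff]
  refine exists_congr fun a => ?_
  rw [isVertex_kStar_iff hl, ← and_assoc, add_comm a]
  refine and_congr_left fun _ => ⟨fun ⟨⟨h1, h2⟩, h⟩ => ?_, fun ⟨h1, h2⟩ => ?_⟩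
  · rw [isConstantClass_kStar_iff hl h1 h2] at h
    omega
  · rw [isConstantClass_kStar_iff hl (by omega) h2]
    omega

theorem isConstantClass_kStar_succ {l b : ℕ} (hl : Odd l) (hb : IsVertex l (kStar l + 1) b) :
    IsConstantClass l (kStar l + 1) b := by
  obtain ⟨a, ⟨h1, h2⟩, rfl | rfl⟩ := (isVertex_kStar_succ_iff hl).1 hb
  · exact ⟨_, (hasConstant_kStar_succ hl h1 h2).1⟩
  · exact ⟨_, (hasConstant_kStar_succ hl h1 h2).2⟩

theorem generation_kStar_succ_eq_terminals {l : ℕ} (hl : Odd l) :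
    generation l (kStar l + 1) = terminals l (kStar l + 1) :=
  Set.ext fun _ => ⟨fun h => ⟨h, isConstantClass_kStar_succ hl h⟩, fun h => h.1⟩

theorem generation_eq_empty {l k : ℕ} (hl : Odd l) (hk : kStar l + 1 < k) :
    generation l k = ∅ := by
  induction k, hk using Nat.le_induction with
  | base =>
    refine Set.eq_empty_of_forall_notMem fun b hb => ?_
    obtain ⟨a, h, h', -⟩ := isVertex_succ_iff.1 hb
    exact h' (isConstantClass_kStar_succ hl h)
  | succ k hk ih =>
    refine Set.eq_empty_of_forall_notMem fun b hb => ?_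
    obtain ⟨a, h, -, -⟩ := isVertex_succ_iff.1 hb
    exact Set.eq_empty_iff_forall_notMem.1 ih a h

theorem encard_Icc (a b : ℕ) : (Set.Icc a b).encard = ((b + 1 - a : ℕ) : ℕ∞) := by
  rw [← Finset.coe_Icc, Set.encard_coe_eq_coe_finsetCard, Nat.card_Icc]

theorem encard_generation_kStar_succ {l : ℕ} (hl : Odd l) :
    (generation l (kStar l + 1)).encard = ((2 * (l - 2 ^ kStar l) : ℕ) : ℕ∞) := by
  have h1 := two_pow_kStar_le hl.pos
  have h2 := lt_two_pow_kStar_succ l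
  have e : 2 ^ (kStar l + 1) = 2 ^ kStar l * 2 := pow_succ _ _
  have hset : generation l (kStar l + 1) =
      Set.Icc (2 ^ (kStar l + 1) - l + 1) (2 ^ kStar l) ∪
        Set.Icc (2 ^ (kStar l + 1) - l + 1 + 2 ^ kStar l) (2 ^ kStar l + 2 ^ kStar l) := by
    ext b
    simp only [generation, Set.mem_ofPred_eq, isVertex_kStar_succ_iff hl, Set.mem_union,
      Set.mem_Icc]
    constructor
    · rintro ⟨a, ha, rfl | rfl⟩ <;> omega
    · rintro (h | h)
      · exact ⟨b, h, Or.inl rfl⟩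
      · exact ⟨b - 2 ^ kStar l, by omega, Or.inr (by omega)⟩
  rw [hset, Set.encard_union_eq, encard_Icc, encard_Icc, ← Nat.cast_add]
  · congr 1
    omega
  · rw [Set.disjoint_left]
    intro b hb hb'
    rw [Set.mem_Icc] at hb hb'
    omega

theorem HasConstant.nu2_CSeq_eq {l k a : ℕ} {c : ℤ} (h : HasConstant l k a c) {m : ℕ}
    (hm : 1 ≤ m) : nu2 (CSeq l (2 ^ k * (m - 1) + a)) = nu2 (m : ℚ) + c := by
  rw [← h m hm]
  ring

end QuarticValuation

theorem mainTheorem8 (l : ℕ) (hl : 1 ≤ l) :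
    -- 1) `T(2^r l) = T(l)` up to the labels, and the labels are all shifted by `3 (2^r - 1) l`
    (∀ r : ℕ, treeShape (2 ^ r * l) = treeShape l ∧
      ∀ m : ℕ, 1 ≤ m →
        nu2 (CSeq (2 ^ r * l) m) = nu2 (CSeq l m) + 3 * (2 ^ r - 1) * (l : ℤ)) ∧
    (Odd l →
      -- 2) complete binary tree through generation `k*`
      ((∀ k ≤ kStar l, (generation l k).encard = ((2 ^ k : ℕ) : ℕ∞)) ∧
        (∀ k < kStar l, terminals l k = ∅)) ∧
      -- 3) terminal vertices of generation `k*`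
      ((terminals l (kStar l)).encard = ((2 ^ (kStar l + 1) - l : ℕ) : ℕ∞) ∧
        ∀ a : ℕ, 1 ≤ a → a ≤ 2 ^ (kStar l + 1) - l →
          HasLabel l (kStar l) a (gamma1 l (kStar l) a) ∧
          ∀ m : ℕ, 1 ≤ m →
            nu2 (CSeq l (2 ^ kStar l * (m - 1) + a)) =
              nu2 (m : ℚ) + gamma1 l (kStar l) a) ∧
      -- 4) the remaining terminal vertices lie in generation `k* + 1`, where the tree ends
      ((terminals l (kStar l + 1)).encard = ((2 * (l - 2 ^ kStar l) : ℕ) : ℕ∞) ∧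
        generation l (kStar l + 1) = terminals l (kStar l + 1) ∧
        (∀ k : ℕ, kStar l + 1 < k → generation l k = ∅) ∧
        ∀ a : ℕ, 2 ^ (kStar l + 1) - l + 1 ≤ a → a ≤ 2 ^ kStar l →
          HasLabel l (kStar l + 1) a (gamma2 l (kStar l) a) ∧
          HasLabel l (kStar l + 1) (a + 2 ^ kStar l) (gamma3 l (kStar l) a) ∧
          (∀ m : ℕ, 1 ≤ m →
            nu2 (CSeq l (2 ^ (kStar l + 1) * (m - 1) + a)) =
              nu2 (m : ℚ) + gamma2 l (kStar l) a) ∧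
          ∀ m : ℕ, 1 ≤ m →
            nu2 (CSeq l (2 ^ (kStar l + 1) * (m - 1) + a + 2 ^ kStar l)) =
              nu2 (m : ℚ) + gamma3 l (kStar l) a)) := by
  refine ⟨fun r => ⟨treeShape_two_pow_mul hl r, fun m _ => nu2_CSeq_two_pow_mul hl r m⟩,
    fun hodd => ⟨⟨fun k hk => ?_, fun k hk => ?_⟩, ⟨?_, fun a ha ha' => ?_⟩, ?_,
      generation_kStar_succ_eq_terminals hodd, fun k hk => generation_eq_empty hodd hk,
      fun a ha ha' => ?_⟩⟩
  · rw [generation_eq_Icc hodd hk, encard_Icc, Nat.add_sub_cancel]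
  · refine Set.eq_empty_of_forall_notMem fun a ⟨hv, hc⟩ => ?_
    have hmem : a ∈ Set.Icc 1 (2 ^ k) := generation_eq_Icc hodd hk.le ▸ hv
    exact not_isConstantClass_of_lt_kStar hodd hk hmem.1 hmem.2 hc
  · rw [terminals_kStar hodd, encard_Icc, Nat.add_sub_cancel]
  · have hc := hasConstant_kStar hodd ha ha'
    have hv : a ∈ terminals l (kStar l) := terminals_kStar hodd ▸ ⟨ha, ha'⟩
    exact ⟨⟨hv.1, hc⟩, fun m hm => hc.nu2_CSeq_eq hm⟩
  · rw [← generation_kStar_succ_eq_terminals hodd, encard_generation_kStar_succ hodd]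
  · obtain ⟨h2, h3⟩ := hasConstant_kStar_succ hodd ha ha'
    refine ⟨⟨(isVertex_kStar_succ_iff hodd).2 ⟨a, ⟨ha, ha'⟩, Or.inl rfl⟩, h2⟩,
      ⟨(isVertex_kStar_succ_iff hodd).2 ⟨a, ⟨ha, ha'⟩, Or.inr rfl⟩, h3⟩,
      fun m hm => h2.nu2_CSeq_eq hm, fun m hm => ?_⟩
    rw [add_assoc]
    exact h3.nu2_CSeq_eq hm
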